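/- We work in the deterministic $\mathsf{CONGEST}$ model. The input graph $G=(V,E)$ is a finite connected simple graph with $n=|V|$ nodes, which is also the communication network. Nodes have distinct identifiers in $\{0,\dots,N-1\}$, where $N\le n^{c}$ for a constant $c$; initially each node knows only $N$, its own identifier and its degree (the number of its incident edges, which it distinguishes by locally numbered ports; the numbering is arbitrary), and all nodes know the pattern graph $H$. Computation proceeds in synchronous rounds; in each round every node may send a possibly different message of $O(\log n)$ bits along each of its edges, receives the messages of its neighbours, and performs unrestricted local computation. Each node eventually halts with a local output. The number of rounds is counted until all nodes have halted. The vertex cover number $\tau(G)$ is the minimum size of a set of nodes that meets every edge of $G$. \textbf{Theorem.} There is an absolute constant $C$ such that for every constant $c$ there is a constant $b$ with the following property. For every finite simple graph $H$ with node set $V_H$ and $k=|V_H|$, there is a deterministic $\mathsf{CONGEST}$ algorithm with messages of at most $b\lceil\log_2 n\rceil$ bits which, on every finite connected graph $G$ with $n$ nodes, every assignment of distinct identifiers in $\{0,\dots,N-1\}$ with $N\le n^{c}$, and every port numbering, halts within $$2^{\,C(\tau(G)+k)^2}$$ rounds (independently of $n$, and without $\tau(G)$ being given to the nodes) and solves induced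 $H$-detection, including finding a copy: every node reports whether $G$ contains $H$ as an induced subgraph, and moreover every node $v$ outputs $f(v)\in V_H\cup\{\bot\}$ such that, if $G$ contains an induced copy of $H$, then $f$ restricted to $U=\{v: f(v)\neq\bot\}$ is an isomorphism from $G[U]$ onto $H$, and otherwise $f(v)=\bot$ for all $v$. -/

import Mathlib

universe u v

/-- A deterministic algorithm for the `CONGEST` model: one and the same program is run by all nodes.
Local computation is unrestricted, messages are bit strings (the empty string means silence).
A node starts with a bound on the identifiers, its own identifier and its degree. In particular it
does not know the identifiers of its neighbours. -/
structure CongestAlgorithm (Out : Type u) where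
  /-- local states of a node -/
  State : Type u
  /-- initial state, from the identifier bound, the own identifier and the own degree -/
  init : (idBound id degree : ℕ) → State
  /-- the message sent through the port with the given number -/
  send : State → ℕ → List Bool
  /-- new state from the old one and the messages received in this round, listed by port -/
  receive : State → List (List Bool) → State
  /-- `some o` when the node has halted with local output `o`, `none` while it is running -/
  output : State → Option Out

/-- A communication network: a graph on the node set `V`, distinct identifiers in
`{0, …, idBound - 1}`, and at each node a numbering of its incident edges by ports
`0, …, deg - 1`. -/
structure CongestNetwork (V : Type v) where
  graph : SimpleGraph V
  idBound : ℕ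
  id : V ↪ Fin idBound
  deg : V → ℕ
  port : (x : V) → Fin (deg x) ≃ graph.neighborSet x

namespace CongestNetwork

variable {V : Type v} {Out : Type u}

/-- The message that node `x` in global state `s` sends through port `i`; a halted node is silent. -/
def message (N : CongestNetwork V) (A : CongestAlgorithm Out) (s : V → A.State)
    (x : V) (i : Fin (N.deg x)) : List Bool :=
  if (A.output (s x)).isSome then [] else A.send (s x) i

/-- The port of the neighbour `y` reached from `x` through port `i` that leads back to `x`. -/
def backPort (N : CongestNetwork V) (x : V) (i : Fin (N.deg x)) :
    Fin (N.deg (N.port x i : V)) :=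
  (N.port (N.port x i : V)).symm ⟨x, SimpleGraph.Adj.symm (N.port x i).2⟩

/-- The messages arriving at node `x`, listed by the ports of `x`. -/
def inbox (N : CongestNetwork V) (A : CongestAlgorithm Out) (s : V → A.State) (x : V) :
    List (List Bool) :=
  List.ofFn fun i : Fin (N.deg x) => N.message A s (N.port x i : V) (N.backPort x i)

/-- The global state after `t` synchronous rounds; a node that has halted keeps its state. -/
def run (N : CongestNetwork V) (A : CongestAlgorithm Out) : ℕ → V → A.State
  | 0 => fun x => A.init N.idBound (N.id x) (N.deg x)
  | t + 1 => fun x =>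
      if (A.output (N.run A t x)).isSome then N.run A t x
      else A.receive (N.run A t x) (N.inbox A (N.run A t) x)

/-- In every round, every message sent along an edge has at most `B` bits. -/
def RespectsBandwidth (N : CongestNetwork V) (A : CongestAlgorithm Out) (B : ℕ) : Prop :=
  ∀ (t : ℕ) (x : V) (i : Fin (N.deg x)), (N.message A (N.run A t) x i).length ≤ B

/-- After `T` rounds all nodes have halted, with local outputs given by `out`. -/
def HaltsWith (N : CongestNetwork V) (A : CongestAlgorithm Out) (T : ℕ) (out : V → Out) : Prop :=
  ∀ x : V, A.output (N.run A T x) = some (out x)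

end CongestNetwork

/-- Local output of a node in induced `H`-detection, where `W` is the node set of `H`: whether the
input contains an induced copy of `H`, and the node of `H` whose part the node plays in the copy
that was found (`none` if it is not in that copy). -/
structure DetectionAnswer (W : Type u) where
  found : Bool
  role : Option W

/-- The local outputs solve induced `H`-detection on `G`: every node reports correctly whether `G`
contains an induced copy of `H`; if so, the roles mark one induced copy of `H` in `G`, and
otherwise nobody has a role. -/
def IsInducedDetection {V : Type v} {W : Type u} (G : SimpleGraph V) (H : SimpleGraph W)
    (out : V → DetectionAnswer W) : Prop :=
  (∀ x, (out x).found = true ↔ H.IsIndContained G) ∧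
  (H.IsIndContained G → ∃ φ : H ↪g G, ∀ x w, (out x).role = some w ↔ φ w = x) ∧
  (¬ H.IsIndContained G → ∀ x, (out x).role = none)

/-!
The algorithm runs phases `t = 0, 1, …`, where `t` is a guess for the vertex cover number. Phase `t`
keeps the nodes of degree more than `t` and the first `q + 1` nodes of each class of twins, where
`q` is the number of nodes of `H`. An induced copy of `H` whose identifiers have minimal sum uses
kept nodes only, because any other node of the copy could be exchanged with a smaller twin outside
the copy. If there is a vertex cover `X` with at most `t` nodes, then every kept node outside `X`
has one of the first `q + 1` ranks among the nodes with its neighbourhood, which is a subset of `X`;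
so at most `t + 2 ^ t * (q + 1)` nodes are kept. Hence the graph `K` that they induce is encoded by
at most `m = (t + 2 ^ t * (q + 1)) ^ 2` numbers.

A node finds out by local communication whether it is kept, and `K` is then flooded for `m + 1`
steps, where at most `m + 1` numbers cross an edge per step. A node that knows at most `m` numbers
at the end has lost nothing, so that it knows everything within distance `m + 1`; and since every
distance layer except the last contains a kept node, no node is farther away. So it knows all of
`K`. Consequently either all nodes know `K` and choose the same copy of `H` in it, or all nodes see
that `K` is too large and enter the next phase.
-/

section Truncate

variable {α : Type*} [DecidableEq α]

/-- A subset of `S` with `min m #S` elements: the part of `S` that can be sent over an edge in `m`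
rounds, one element per round, in the order of `S.toList`. -/
noncomputable def truncate (m : ℕ) (S : Finset α) : Finset α := (S.toList.take m).toFinset

theorem truncate_subset (m : ℕ) (S : Finset α) : truncate m S ⊆ S := fun _ ha =>
  Finset.mem_toList.1 (List.mem_of_mem_take (List.mem_toFinset.1 ha))

theorem card_truncate (m : ℕ) (S : Finset α) : (truncate m S).card = min m S.card := by
  rw [truncate, List.toFinset_card_of_nodup S.nodup_toList.take, List.length_take,
    Finset.length_toList]

theorem truncate_of_card_le {m : ℕ} {S : Finset α} (h : S.card ≤ m) : truncate m S = S :=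
  Finset.eq_of_subset_of_card_le (truncate_subset m S) (by rw [card_truncate, min_eq_right h])

theorem truncate_succ (m : ℕ) (S : Finset α) :
    truncate (m + 1) S = truncate m S ∪ S.toList[m]?.toFinset := by
  simp only [truncate, List.take_add_one, List.toFinset_append]
  congr 1
  cases S.toList[m]? <;> rfl

theorem truncate_eq_truncate_iff {m : ℕ} {S T : Finset α} (hT : T.card < m) :
    truncate m S = truncate m T ↔ S = T := by
  refine ⟨fun h => ?_, congrArg _⟩
  have hcard := congrArg Finset.card h
  rw [card_truncate, card_truncate] at hcard
  rwa [truncate_of_card_le (by omega), truncate_of_card_le hT.le] at h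

end Truncate

/-- The message that carries an optional number; `none` is encoded by silence. -/
def encodeMessage (o : Option ℕ) : List Bool := (o.elim 0 Nat.succ).bits

/-- The inverse of `encodeMessage`. -/
def decodeMessage (l : List Bool) : Option ℕ :=
  (Nat.ofDigits 2 (l.map fun b => cond b 1 0)).ppred

theorem decodeMessage_encodeMessage (o : Option ℕ) : decodeMessage (encodeMessage o) = o := by
  rw [decodeMessage, encodeMessage, ← Nat.digits_two_eq_bits, Nat.ofDigits_digits]
  cases o <;> rfl

theorem length_encodeMessage_le {K : ℕ} {o : Option ℕ} (h : ∀ a ∈ o, a < K) :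
    (encodeMessage o).length ≤ K.size := by
  rw [encodeMessage, Nat.size_eq_bits_len]
  refine Nat.size_le_size ?_
  cases o with
  | none => exact K.zero_le
  | some a => exact h a rfl

/-- What a node knows at the beginning. -/
structure NodeInfo where
  idBound : ℕ
  id : ℕ
  degree : ℕ

/-- One phase of a synchronous protocol. It consists of `blocks` blocks of `cap` rounds each. In a
block every node offers a finite set of numbers to each port, one of which is transmitted per round,
so that at most `cap` of them arrive; numbers that are not below `idBound ^ 2` are suppressed,
which keeps the messages short. The local data of a node of degree `d` have type `Loc d`. -/
structure Phase (Out : Type u) where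
  Loc : ℕ → Type
  start : (info : NodeInfo) → Loc info.degree
  send : (block : ℕ) → (info : NodeInfo) → Loc info.degree → Fin info.degree → Finset ℕ
  step : (block : ℕ) → (info : NodeInfo) → Loc info.degree → (Fin info.degree → Finset ℕ) →
    Loc info.degree
  /-- the output of the node, or `none` if it enters the next phase -/
  result : (info : NodeInfo) → Loc info.degree → Option Out
  cap : ℕ
  blocks : ℕ
  cap_pos : 0 < cap
  blocks_pos : 0 < blocks

namespace Phase

variable {Out : Type u} (P : ℕ → Phase Out)

/-- The numbers below `idBound ^ 2` that a node offers to a port in a block. -/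
def offer (F : Phase Out) (b : ℕ) (info : NodeInfo) (loc : F.Loc info.degree)
    (i : Fin info.degree) : Finset ℕ :=
  {a ∈ F.send b info loc i | a < info.idBound ^ 2}

/-- State of a node that runs the phases `P 0, P 1, …` in succession. -/
structure NodeState where
  info : NodeInfo
  phase : ℕ
  block : ℕ
  /-- the number of completed rounds of the current block -/
  round : ℕ
  /-- the numbers received in the current block, by ports -/
  received : Fin info.degree → Finset ℕ
  loc : (P phase).Loc info.degree
  answer : Option Out

/-- State of a node at the beginning of phase `t`, where `answer` is the result of the phase
before. -/
def phaseStart (info : NodeInfo) (t : ℕ) (answer : Option Out) : NodeState P :=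
  ⟨info, t, 0, 0, fun _ => ∅, (P t).start info, answer⟩

/-- State of a node at the end of a block in which it has received `inb`. -/
def finishBlock (s : NodeState P) (inb : Fin s.info.degree → Finset ℕ) : NodeState P :=
  let loc := (P s.phase).step s.block s.info s.loc inb
  if s.block + 1 < (P s.phase).blocks then
    ⟨s.info, s.phase, s.block + 1, 0, fun _ => ∅, loc, none⟩
  else phaseStart P s.info (s.phase + 1) ((P s.phase).result s.info loc)

/-- The message that a node sends through a port. -/
noncomputable def sendRound (s : NodeState P) (i : ℕ) : List Bool :=
  if h : i < s.info.degree then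
    encodeMessage ((P s.phase).offer s.block s.info s.loc ⟨i, h⟩).toList[s.round]?
  else []

/-- State of a node after a round in which it has received `inbox`. -/
def receiveRound (s : NodeState P) (inbox : List (List Bool)) : NodeState P :=
  let received := fun i : Fin s.info.degree =>
    s.received i ∪ (decodeMessage (inbox.getD i [])).toFinset
  if s.round + 1 < (P s.phase).cap then { s with round := s.round + 1, received := received }
  else finishBlock P s received

/-- The `CONGEST` algorithm that runs the phases `P 0, P 1, …` until one of them has a result. A
node for which `early` is not `none` halts without any communication. -/
noncomputable def toCongest (early : NodeInfo → Option Out) : CongestAlgorithm Out where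
  State := NodeState P
  init N id d := phaseStart P ⟨N, id, d⟩ 0 (early ⟨N, id, d⟩)
  send := sendRound P
  receive := receiveRound P
  output := NodeState.answer

theorem length_sendRound_le (s : NodeState P) (i : ℕ) :
    (sendRound P s i).length ≤ (s.info.idBound ^ 2).size := by
  unfold sendRound
  split_ifs
  · refine length_encodeMessage_le fun a ha => ?_
    have hmem := Finset.mem_toList.1 (List.mem_of_getElem? ha)
    exact (Finset.mem_filter.1 hmem).2
  · exact Nat.zero_le _

theorem info_receiveRound (s : NodeState P) (inbox : List (List Bool)) :
    (receiveRound P s inbox).info = s.info := by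
  simp only [receiveRound, finishBlock, phaseStart]
  split_ifs <;> rfl

end Phase

namespace CongestNetwork

section Simulation

variable {V : Type v} {Out : Type u} (N : CongestNetwork V)

/-- What node `x` knows at the beginning. -/
abbrev info (x : V) : NodeInfo := ⟨N.idBound, N.id x, N.deg x⟩

section OnePhase

variable (F : Phase Out)

/-- The numbers that node `x` is offered through port `i` in block `b`, if the local data are given
by `s`. -/
def offered (b : ℕ) (s : ∀ x, F.Loc (N.deg x)) (x : V) (i : Fin (N.deg x)) : Finset ℕ :=
  F.offer b (N.info (N.port x i)) (s (N.port x i)) (N.backPort x i)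

/-- The local data after `b` blocks of the phase `F`. -/
noncomputable def blockRun : ℕ → ∀ x, F.Loc (N.deg x)
  | 0 => fun x => F.start (N.info x)
  | b + 1 => fun x => F.step b (N.info x) (blockRun b x) fun i =>
      truncate F.cap (N.offered F b (blockRun b) x i)

/-- The numbers that node `x` receives through port `i` in the first `j` rounds of block `b`. -/
noncomputable def received (b j : ℕ) (x : V) (i : Fin (N.deg x)) : Finset ℕ :=
  truncate j (N.offered F b (N.blockRun F b) x i)

theorem blockRun_succ (b : ℕ) (x : V) : N.blockRun F (b + 1) x =
    F.step b (N.info x) (N.blockRun F b x) (N.received F b F.cap x) :=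
  rfl

variable {F} in
theorem received_eq_truncate {b : ℕ} {x : V} {i : Fin (N.deg x)} {S : Finset ℕ}
    (hsend : F.send b (N.info (N.port x i)) (N.blockRun F b (N.port x i)) (N.backPort x i) = S)
    (hS : ∀ a ∈ S, a < N.idBound ^ 2) (j : ℕ) : N.received F b j x i = truncate j S := by
  subst hsend
  exact congrArg (truncate j) (Finset.filter_true_of_mem hS)

/-- The result of the phase `F` at node `x`. -/
noncomputable def phaseResult (x : V) : Option Out :=
  F.result (N.info x) (N.blockRun F F.blocks x)

end OnePhase

variable (P : ℕ → Phase Out) (early : NodeInfo → Option Out)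

/-- State of node `x` in phase `t` after `b` blocks and `j` further rounds. -/
noncomputable def stateAt (t b j : ℕ) (x : V) : Phase.NodeState P :=
  ⟨N.info x, t, b, j, N.received (P t) b j x, N.blockRun (P t) b x, none⟩

theorem decodeMessage_inbox_stateAt (t b j : ℕ) (x : V) (i : Fin (N.deg x)) :
    decodeMessage ((N.inbox (Phase.toCongest P early) (N.stateAt P t b j) x).getD i []) =
      (N.offered (P t) b (N.blockRun (P t) b) x i).toList[j]? := by
  have hmsg : (N.inbox (Phase.toCongest P early) (N.stateAt P t b j) x).getD i [] =
      encodeMessage (N.offered (P t) b (N.blockRun (P t) b) x i).toList[j]? := by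
    simp [inbox, message, Phase.toCongest, Phase.sendRound, stateAt, offered, List.getD]
  rw [hmsg, decodeMessage_encodeMessage]

theorem receiveRound_stateAt {t b j : ℕ} {x : V} {inbox : List (List Bool)}
    (hinbox : ∀ i : Fin (N.deg x), decodeMessage (inbox.getD i []) =
      (N.offered (P t) b (N.blockRun (P t) b) x i).toList[j]?) :
    Phase.receiveRound P (N.stateAt P t b j x) inbox =
      if j + 1 < (P t).cap then N.stateAt P t b (j + 1) x
      else Phase.finishBlock P (N.stateAt P t b j x) (N.received (P t) b (j + 1) x) := by
  have hreceived : (fun i : Fin (N.deg x) =>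
      N.received (P t) b j x i ∪ (decodeMessage (inbox.getD i [])).toFinset) =
        N.received (P t) b (j + 1) x :=
    funext fun i => by rw [hinbox, received, received, truncate_succ]
  simp only [stateAt, ← hreceived]
  rfl

theorem run_succ_of_eq_stateAt {T t b j : ℕ}
    (h : N.run (Phase.toCongest P early) T = N.stateAt P t b j) :
    N.run (Phase.toCongest P early) (T + 1) = fun x =>
      if j + 1 < (P t).cap then N.stateAt P t b (j + 1) x
      else Phase.finishBlock P (N.stateAt P t b j x) (N.received (P t) b (j + 1) x) := by
  funext x
  rw [run, h]
  exact (if_neg Bool.false_ne_true).trans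
    (N.receiveRound_stateAt P (N.decodeMessage_inbox_stateAt P early t b j x))

theorem run_add_of_lt_cap {T t b j : ℕ} (h : N.run (Phase.toCongest P early) T = N.stateAt P t b 0)
    (hj : j < (P t).cap) : N.run (Phase.toCongest P early) (T + j) = N.stateAt P t b j := by
  induction j with
  | zero => exact h
  | succ j ih =>
    rw [← add_assoc, N.run_succ_of_eq_stateAt P early (ih (by omega))]
    funext x
    rw [if_pos hj]

theorem run_add_cap {T t b : ℕ} (h : N.run (Phase.toCongest P early) T = N.stateAt P t b 0) :
    N.run (Phase.toCongest P early) (T + (P t).cap) = fun x =>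
      if b + 1 < (P t).blocks then N.stateAt P t (b + 1) 0 x
      else Phase.phaseStart P (N.info x) (t + 1)
        ((P t).result (N.info x) (N.blockRun (P t) (b + 1) x)) := by
  obtain ⟨m, hm⟩ := Nat.exists_eq_succ_of_ne_zero (P t).cap_pos.ne'
  have hrun := N.run_add_of_lt_cap P early h (j := m) (by omega)
  rw [hm, Nat.succ_eq_add_one, ← add_assoc, N.run_succ_of_eq_stateAt P early hrun]
  funext x
  rw [if_neg (by omega), ← Nat.succ_eq_add_one m, ← hm]
  rfl

theorem run_add_mul_cap {T t b : ℕ} (h : N.run (Phase.toCongest P early) T = N.stateAt P t 0 0)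
    (hb : b < (P t).blocks) :
    N.run (Phase.toCongest P early) (T + b * (P t).cap) = N.stateAt P t b 0 := by
  induction b with
  | zero => rwa [Nat.zero_mul]
  | succ b ih =>
    rw [Nat.succ_mul, ← add_assoc, N.run_add_cap P early (ih (by omega))]
    funext x
    rw [if_pos hb]

theorem run_add_blocks_mul_cap {T t : ℕ}
    (h : N.run (Phase.toCongest P early) T = N.stateAt P t 0 0) :
    N.run (Phase.toCongest P early) (T + (P t).blocks * (P t).cap) = fun x =>
      Phase.phaseStart P (N.info x) (t + 1) (N.phaseResult (P t) x) := by
  obtain ⟨m, hm⟩ := Nat.exists_eq_succ_of_ne_zero (P t).blocks_pos.ne'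
  have hrun := N.run_add_mul_cap P early h (b := m) (by omega)
  rw [hm, Nat.succ_mul, ← add_assoc, N.run_add_cap P early hrun]
  funext x
  rw [if_neg (by omega), phaseResult, hm]

theorem run_sum_eq_stateAt {t : ℕ} (hearly : ∀ x, early (N.info x) = none)
    (hresult : ∀ s < t, ∀ x, N.phaseResult (P s) x = none) :
    N.run (Phase.toCongest P early) (∑ s ∈ Finset.range t, (P s).blocks * (P s).cap) =
      N.stateAt P t 0 0 := by
  induction t with
  | zero =>
    funext x
    change Phase.phaseStart P (N.info x) 0 (early (N.info x)) = _
    rw [hearly]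
    rfl
  | succ t ih =>
    rw [Finset.sum_range_succ,
      N.run_add_blocks_mul_cap P early (ih fun s hs => hresult s (hs.trans t.lt_succ_self))]
    funext x
    rw [hresult t t.lt_succ_self]
    rfl

theorem haltsWith_of_phaseResult {t : ℕ} {out : V → Out} (hearly : ∀ x, early (N.info x) = none)
    (hnone : ∀ s < t, ∀ x, N.phaseResult (P s) x = none)
    (hsome : ∀ x, N.phaseResult (P t) x = some (out x)) :
    N.HaltsWith (Phase.toCongest P early)
      (∑ s ∈ Finset.range (t + 1), (P s).blocks * (P s).cap) out := by
  intro x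
  rw [Finset.sum_range_succ,
    N.run_add_blocks_mul_cap P early (N.run_sum_eq_stateAt P early hearly hnone)]
  exact hsome x

theorem info_run (T : ℕ) (x : V) : (N.run (Phase.toCongest P early) T x).info = N.info x := by
  induction T with
  | zero => rfl
  | succ T ih =>
    simp only [run]
    split_ifs
    · exact ih
    · exact (Phase.info_receiveRound P _ _).trans ih

theorem respectsBandwidth_toCongest :
    N.RespectsBandwidth (Phase.toCongest P early) (N.idBound ^ 2).size := by
  intro T x i
  rw [message]
  split_ifs
  · exact Nat.zero_le _
  · refine (Phase.length_sendRound_le P _ _).trans_eq ?_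
    rw [info_run]

end Simulation

end CongestNetwork

section Twins

variable {V : Type v} {W : Type u} {G : SimpleGraph V} {H : SimpleGraph W}

theorem adj_congr_of_neighborSet_eq {x y : V} (h : G.neighborSet x = G.neighborSet y) (z : V) :
    G.Adj x z ↔ G.Adj y z :=
  Set.ext_iff.1 h z

theorem neighborSet_swap [DecidableEq V] {y z : V} (h : G.neighborSet y = G.neighborSet z)
    (a : V) : G.neighborSet (Equiv.swap y z a) = G.neighborSet a := by
  rw [Equiv.swap_apply_def]
  split_ifs with hy hz
  · rw [hy, h]
  · rw [hz, h]
  · rfl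

/-- The automorphism that exchanges two twins, that is, two nodes with the same neighbours. -/
def swapTwins [DecidableEq V] {y z : V} (h : G.neighborSet y = G.neighborSet z) : G ≃g G where
  toEquiv := Equiv.swap y z
  map_rel_iff' {a b} := by
    rw [adj_congr_of_neighborSet_eq (neighborSet_swap h a), G.adj_comm,
      adj_congr_of_neighborSet_eq (neighborSet_swap h b), G.adj_comm]

/-- The position of `y` among its twins, in the order given by `key`. -/
noncomputable def twinRank (G : SimpleGraph V) (key : V → ℕ) (y : V) : ℕ :=
  {z | G.neighborSet z = G.neighborSet y ∧ key z < key y}.ncard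

theorem twinRank_lt_twinRank [Finite V] {key : V → ℕ} {y z : V}
    (h : G.neighborSet y = G.neighborSet z) (hkey : key y < key z) :
    twinRank G key y < twinRank G key z :=
  Set.ncard_lt_ncard ⟨fun _ ha => ⟨ha.1.trans h, ha.2.trans hkey⟩, fun hsub =>
    lt_irrefl _ (hsub (a := y) ⟨h, hkey⟩).2⟩

theorem injective_neighborSet_twinRank [Finite V] {key : V → ℕ} (hkey : Function.Injective key) :
    Function.Injective fun y => (G.neighborSet y, twinRank G key y) := by
  intro y z hyz
  obtain ⟨hset, hrank⟩ := Prod.mk.inj hyz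
  rcases lt_trichotomy (key y) (key z) with hlt | heq | hgt
  · exact absurd hrank (twinRank_lt_twinRank hset hlt).ne
  · exact hkey heq
  · exact absurd hrank (twinRank_lt_twinRank hset.symm hgt).ne'

/-- The nodes of the kernel: those of degree more than `t`, and the first `q + 1` nodes of each
class of twins, in the order given by `key`. -/
def IsKept (G : SimpleGraph V) (key : V → ℕ) (t q : ℕ) (y : V) : Prop :=
  t < (G.neighborSet y).ncard ∨ twinRank G key y ≤ q

theorem exists_isKept_twin (G : SimpleGraph V) (key : V → ℕ) (t q : ℕ) (y : V) :
    ∃ z, IsKept G key t q z ∧ G.neighborSet z = G.neighborSet y := by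
  obtain ⟨z, hz, hmin⟩ := WellFounded.has_min (measure key).wf
    {z | G.neighborSet z = G.neighborSet y} ⟨y, rfl⟩
  have hempty : {a | G.neighborSet a = G.neighborSet z ∧ key a < key z} = ∅ :=
    Set.eq_empty_of_forall_notMem fun a ha => hmin a (ha.1.trans hz) ha.2
  refine ⟨z, Or.inr ?_, hz⟩
  rw [twinRank, hempty, Set.ncard_empty]
  exact q.zero_le

theorem exists_embedding_key_lt [Finite W] {key : V → ℕ} {q : ℕ} (hq : Nat.card W ≤ q)
    (ψ : H ↪g G) {w : W} (hw : q < twinRank G key (ψ w)) :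
    ∃ χ : H ↪g G, key (χ w) < key (ψ w) ∧ ∀ a ≠ w, χ a = ψ a := by
  classical
  have hrange : (Set.range ψ).ncard ≤ q :=
    (Set.ncard_range_of_injective ψ.injective).trans_le hq
  obtain ⟨z, ⟨htwin, hlt⟩, hz⟩ :=
    Set.exists_mem_notMem_of_ncard_lt_ncard (hrange.trans_lt hw) (Set.finite_range ψ)
  refine ⟨(swapTwins htwin.symm).toEmbedding.comp ψ, ?_, fun a ha => ?_⟩
  · change key (Equiv.swap (ψ w) z (ψ w)) < _
    rwa [Equiv.swap_apply_left]
  · exact Equiv.swap_apply_of_ne_of_ne (ψ.injective.ne ha) fun h => hz ⟨a, h⟩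

theorem exists_embedding_isKept [Finite W] (key : V → ℕ) (t : ℕ) {q : ℕ} (hq : Nat.card W ≤ q)
    (φ : H ↪g G) : ∃ ψ : H ↪g G, ∀ w, IsKept G key t q (ψ w) := by
  have := Fintype.ofFinite W
  obtain ⟨ψ, -, hmin⟩ := WellFounded.has_min
    (measure fun ψ : H ↪g G => ∑ w, key (ψ w)).wf Set.univ ⟨φ, trivial⟩
  refine ⟨ψ, fun w => Or.inr (le_of_not_gt fun hw => ?_)⟩
  obtain ⟨χ, hlt, hχ⟩ := exists_embedding_key_lt hq ψ hw
  have hsum : ∑ a, key (χ a) < ∑ a, key (ψ a) := by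
    refine Finset.sum_lt_sum (fun a _ => ?_) ⟨w, Finset.mem_univ w, hlt⟩
    rcases eq_or_ne a w with rfl | ha
    · exact hlt.le
    · rw [hχ a ha]
  exact hmin χ trivial hsum

variable [Finite V] {key : V → ℕ} {X : Set V} {t q : ℕ}

theorem ncard_isKept_diff_le (hkey : Function.Injective key) (hX : G.IsVertexCover X)
    (ht : X.ncard ≤ t) : ({y | IsKept G key t q y} \ X).ncard ≤ 2 ^ X.ncard * (q + 1) := by
  have hnbrs : ∀ y ∉ X, G.neighborSet y ⊆ X := fun y hy z hz => (hX hz).resolve_left hy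
  have hrank : ∀ y, IsKept G key t q y → y ∉ X → twinRank G key y ≤ q := fun y hkept hy =>
    hkept.resolve_left ((Set.ncard_le_ncard (hnbrs y hy)).trans ht).not_gt
  calc _ ≤ (𝒫 X ×ˢ Set.Iic q).ncard :=
        Set.ncard_le_ncard_of_injOn (fun y => (G.neighborSet y, twinRank G key y))
          (fun y hy => ⟨hnbrs y hy.2, hrank y hy.1 hy.2⟩)
          (injective_neighborSet_twinRank hkey).injOn
    _ = 2 ^ X.ncard * (q + 1) := by
        rw [Set.ncard_prod, Set.ncard_powerset, ← Finset.coe_Iic, Set.ncard_coe_finset,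
          Nat.card_Iic]

theorem ncard_isKept_le (hkey : Function.Injective key) (hX : G.IsVertexCover X)
    (ht : X.ncard ≤ t) : {y | IsKept G key t q y}.ncard ≤ t + 2 ^ t * (q + 1) :=
  calc _ ≤ (X ∪ ({y | IsKept G key t q y} \ X)).ncard :=
        Set.ncard_le_ncard (Set.union_sdiff_self.symm ▸ Set.subset_union_right)
    _ ≤ X.ncard + ({y | IsKept G key t q y} \ X).ncard := Set.ncard_union_le _ _
    _ ≤ t + 2 ^ t * (q + 1) := by
        have hdiff := ncard_isKept_diff_le (q := q) hkey hX ht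
        gcongr
        exact hdiff.trans (by gcongr; exact one_le_two)

end Twins

section Flooding

variable {V : Type v} {G : SimpleGraph V}

theorem dist_getVert {x v : V} {p : G.Walk x v} (hp : p.length = G.dist x v) {d : ℕ}
    (hd : d ≤ G.dist x v) : G.dist x (p.getVert d) = d := by
  rw [← SimpleGraph.length_eq_dist_of_subwalk hp (p.isSubwalk_take d), SimpleGraph.Walk.take_length]
  omega

theorem exists_isKept_dist_eq (hG : G.Connected) (key : V → ℕ) (t q : ℕ) {x v : V} {d : ℕ}
    (hd : d + 1 < G.dist x v) : ∃ z, IsKept G key t q z ∧ G.dist x z = d + 1 := by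
  obtain ⟨p, hp⟩ := hG.exists_walk_length_eq_dist x v
  -- A twin of an inner node of a geodesic is adjacent to the two nodes next to it.
  obtain ⟨z, hz, htwin⟩ := exists_isKept_twin G key t q (p.getVert (d + 1))
  have hprev : G.Adj z (p.getVert d) :=
    (adj_congr_of_neighborSet_eq htwin _).2 (p.adj_getVert_succ (by omega)).symm
  have hnext : G.Adj z (p.getVert (d + 2)) :=
    (adj_congr_of_neighborSet_eq htwin _).2 (p.adj_getVert_succ (by omega))
  have hdist_prev := dist_getVert hp (d := d) (by omega)
  have hdist_next := dist_getVert hp (d := d + 2) (by omega)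
  have hle := hG.dist_triangle (u := x) (v := p.getVert d) (w := z)
  have hge := hG.dist_triangle (u := x) (v := z) (w := p.getVert (d + 2))
  rw [SimpleGraph.dist_eq_one_iff_adj.2 hprev.symm] at hle
  rw [SimpleGraph.dist_eq_one_iff_adj.2 hnext] at hge
  exact ⟨z, hz, by omega⟩

theorem exists_dist_le_of_dist_le_succ (hG : G.Connected) {x y : V} {s : ℕ}
    (h : G.dist x y ≤ s + 1) : ∃ z, (z = x ∨ G.Adj x z) ∧ G.dist z y ≤ s := by
  obtain ⟨p, hp⟩ := hG.exists_walk_length_eq_dist x y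
  cases p with
  | nil => exact ⟨x, Or.inl rfl, by simp⟩
  | cons hadj p =>
    rw [SimpleGraph.Walk.length_cons] at hp
    exact ⟨_, Or.inr hadj, (SimpleGraph.dist_le p).trans (by omega)⟩

variable {α : Type*} [DecidableEq α]

/-- Flooding with bounded messages: `I s x` is the set of items that node `x` knows after `s` steps,
and in each step all nodes send `m + 1` of their items (or all, if there are fewer) to their
neighbours. -/
def IsFlooding (G : SimpleGraph V) (m : ℕ) (I : ℕ → V → Finset α) : Prop :=
  ∀ s x a, a ∈ I (s + 1) x ↔ a ∈ I s x ∨ ∃ y, G.Adj x y ∧ a ∈ truncate (m + 1) (I s y)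

namespace IsFlooding

variable {m : ℕ} {I : ℕ → V → Finset α}

theorem truncate_subset_succ (hI : IsFlooding G m I) {s : ℕ} {x z : V} (hz : z = x ∨ G.Adj x z) :
    truncate (m + 1) (I s z) ⊆ I (s + 1) x := by
  intro a ha
  rcases hz with rfl | hadj
  · exact (hI s z a).2 (Or.inl (truncate_subset _ _ ha))
  · exact (hI s x a).2 (Or.inr ⟨z, hadj, ha⟩)

theorem card_gt_or_ball_subset (hI : IsFlooding G m I) (hG : G.Connected) (s : ℕ) (x : V) :
    m < (I s x).card ∨ ∀ y, G.dist x y ≤ s → I 0 y ⊆ I s x := by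
  induction s generalizing x with
  | zero =>
    refine Or.inr fun y hy => ?_
    rw [hG.dist_eq_zero_iff.1 (Nat.le_zero.1 hy)]
  | succ s ih =>
    refine or_iff_not_imp_left.2 fun hcard y hy => ?_
    obtain ⟨z, hz, hzy⟩ := exists_dist_le_of_dist_le_succ hG hy
    have hsub := hI.truncate_subset_succ (s := s) hz
    have hle : (I s z).card ≤ m := by
      have := Finset.card_le_card hsub
      rw [card_truncate] at this
      omega
    rw [truncate_of_card_le (hle.trans m.le_succ)] at hsub
    exact (((ih z).resolve_left hle.not_gt) y hzy).trans hsub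

theorem exists_mem_zero (hI : IsFlooding G m I) {s : ℕ} {x : V} {a : α} (ha : a ∈ I s x) :
    ∃ y, a ∈ I 0 y := by
  induction s generalizing x with
  | zero => exact ⟨x, ha⟩
  | succ s ih =>
    rcases (hI s x a).1 ha with h | ⟨y, -, h⟩
    · exact ih h
    · exact ih (truncate_subset _ _ h)

variable {key : V → ℕ} {t q : ℕ} {item : V → α}

theorem dist_le_of_card_le (hI : IsFlooding G m I) (hG : G.Connected)
    (hinj : Function.Injective item) (hitem : ∀ z, IsKept G key t q z → item z ∈ I 0 z) {x : V}
    (hcard : (I (m + 1) x).card ≤ m) (y : V) : G.dist x y ≤ m + 1 := by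
  have hball := (hI.card_gt_or_ball_subset hG (m + 1) x).resolve_left hcard.not_gt
  by_contra! hlt
  have hlayer : ∀ d : Fin (m + 1), ∃ z, IsKept G key t q z ∧ G.dist x z = d + 1 := fun d =>
    exists_isKept_dist_eq hG key t q (v := y) (by omega)
  choose z hz hdist using hlayer
  have hz_inj : Function.Injective z := fun d e h => by
    have := congrArg (G.dist x) h
    rw [hdist, hdist] at this
    exact Fin.ext (by omega)
  have hle : (Finset.univ : Finset (Fin (m + 1))).card ≤ (I (m + 1) x).card :=
    Finset.card_le_card_of_injOn (item ∘ z)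
      (fun d _ => hball (z d) (by rw [hdist]; omega) (hitem _ (hz d))) (hinj.comp hz_inj).injOn
  rw [Finset.card_fin] at hle
  omega

theorem eq_of_card_le (hI : IsFlooding G m I) (hG : G.Connected)
    (hinj : Function.Injective item) (hitem : ∀ z, IsKept G key t q z → item z ∈ I 0 z)
    {U : Finset α} (hU : ∀ a, a ∈ U ↔ ∃ x, a ∈ I 0 x) {x : V}
    (hcard : (I (m + 1) x).card ≤ m) : I (m + 1) x = U := by
  refine Finset.Subset.antisymm (fun a ha => (hU a).2 (hI.exists_mem_zero ha)) fun a ha => ?_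
  obtain ⟨y, hy⟩ := (hU a).1 ha
  exact (hI.card_gt_or_ball_subset hG (m + 1) x).resolve_left hcard.not_gt y
    (hI.dist_le_of_card_le hG hinj hitem hcard y) hy

theorem card_le_iff (hI : IsFlooding G m I) (hG : G.Connected)
    (hinj : Function.Injective item) (hitem : ∀ z, IsKept G key t q z → item z ∈ I 0 z)
    {U : Finset α} (hU : ∀ a, a ∈ U ↔ ∃ x, a ∈ I 0 x) (x : V) :
    (I (m + 1) x).card ≤ m ↔ U.card ≤ m :=
  ⟨fun h => hI.eq_of_card_le hG hinj hitem hU h ▸ h,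
    (Finset.card_le_card fun a ha => (hU a).2 (hI.exists_mem_zero ha)).trans⟩

end IsFlooding

end Flooding

/-- `φ` lists the identifiers of an induced copy of `H` in the graph whose reflexive adjacency
relation consists of the pairs of identifiers encoded by `I`. -/
def IsCopy {W : Type u} (H : SimpleGraph W) (I : Finset ℕ) (φ : W → ℕ) : Prop :=
  Function.Injective φ ∧ ∀ w w', Nat.pair (φ w) (φ w') ∈ I ↔ w = w' ∨ H.Adj w w'

open Classical in
/-- The answer of the node with identifier `id` if `I` encodes the kernel. All nodes choose the same
copy of `H`, since the choice depends only on `I`. -/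
noncomputable def kernelAnswer {W : Type u} (H : SimpleGraph W) (I : Finset ℕ) (id : ℕ) :
    DetectionAnswer W :=
  if h : ∃ φ, IsCopy H I φ then ⟨true, Function.partialInv h.choose id⟩ else ⟨false, none⟩

/-- An upper bound on the size of the kernel for `t` and `q` in a graph that has a vertex cover of
at most `t` nodes. -/
def kernelBound (q t : ℕ) : ℕ := (t + 2 ^ t * (q + 1)) ^ 2

theorem lt_kernelBound (q t : ℕ) : t < kernelBound q t := by
  have hpos : 0 < 2 ^ t * (q + 1) := by positivity
  exact (Nat.lt_add_of_pos_right hpos).trans_le (Nat.le_self_pow two_ne_zero _)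

namespace CongestNetwork

section Kernel

variable {V : Type v} {W : Type u} (N : CongestNetwork V) (t q : ℕ)

include N in
theorem finite_nodes : Finite V :=
  Finite.of_injective N.id N.id.injective

/-- The identifier of a node, as a number. -/
def key (x : V) : ℕ := N.id x

theorem key_injective : Function.Injective N.key :=
  Fin.val_injective.comp N.id.injective

theorem key_lt (x : V) : N.key x < N.idBound := (N.id x).2

theorem key_lt_sq (x : V) : N.key x < N.idBound ^ 2 :=
  (N.key_lt x).trans_le (Nat.le_self_pow two_ne_zero _)

theorem pair_key_lt (x y : V) : Nat.pair (N.key x) (N.key y) < N.idBound ^ 2 :=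
  (Nat.pair_lt_max_add_one_sq _ _).trans_le
    (Nat.pow_le_pow_left (max_lt (N.key_lt x) (N.key_lt y)) 2)

theorem pair_key_injective : Function.Injective fun x => Nat.pair (N.key x) (N.key x) :=
  fun _ _ h => N.key_injective (Nat.pair_eq_pair.1 h).1

open Classical in
/-- The kernel: the subgraph induced by the kept nodes, encoded by the pairs of identifiers of equal
or adjacent kept nodes. -/
noncomputable def kernel : Finset ℕ :=
  {a ∈ Finset.range (N.idBound ^ 2) | ∃ x y, IsKept N.graph N.key t q x ∧
    IsKept N.graph N.key t q y ∧ (x = y ∨ N.graph.Adj x y) ∧ a = Nat.pair (N.key x) (N.key y)}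

theorem mem_kernel {a : ℕ} : a ∈ N.kernel t q ↔ ∃ x y, IsKept N.graph N.key t q x ∧
    IsKept N.graph N.key t q y ∧ (x = y ∨ N.graph.Adj x y) ∧
      a = Nat.pair (N.key x) (N.key y) := by
  simp only [kernel, Finset.mem_filter, Finset.mem_range]
  refine and_iff_right_of_imp ?_
  rintro ⟨x, y, -, -, -, rfl⟩
  exact N.pair_key_lt x y

theorem lt_of_mem_kernel {a : ℕ} (ha : a ∈ N.kernel t q) : a < N.idBound ^ 2 := by
  obtain ⟨x, y, -, -, -, rfl⟩ := (N.mem_kernel t q).1 ha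
  exact N.pair_key_lt x y

theorem pair_mem_kernel {x y : V} : Nat.pair (N.key x) (N.key y) ∈ N.kernel t q ↔
    IsKept N.graph N.key t q x ∧ IsKept N.graph N.key t q y ∧ (x = y ∨ N.graph.Adj x y) := by
  rw [mem_kernel]
  refine ⟨?_, fun ⟨hx, hy, hxy⟩ => ⟨x, y, hx, hy, hxy, rfl⟩⟩
  rintro ⟨x', y', hx, hy, hxy, heq⟩
  obtain ⟨hxx', hyy'⟩ := Nat.pair_eq_pair.1 heq
  obtain rfl := N.key_injective hxx'
  obtain rfl := N.key_injective hyy'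
  exact ⟨hx, hy, hxy⟩

theorem kernel_of_subsingleton [Subsingleton V] (x : V) :
    N.kernel t q = {Nat.pair (N.key x) (N.key x)} := by
  obtain ⟨z, hz, -⟩ := exists_isKept_twin N.graph N.key t q x
  obtain rfl := Subsingleton.elim x z
  ext a
  rw [mem_kernel, Finset.mem_singleton]
  refine ⟨?_, fun ha => ⟨x, x, hz, hz, Or.inl rfl, ha⟩⟩
  rintro ⟨y, y', -, -, -, rfl⟩
  rw [Subsingleton.elim y x, Subsingleton.elim y' x]

theorem card_kernel_le {X : Set V} (hX : N.graph.IsVertexCover X) (ht : X.ncard ≤ t) :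
    (N.kernel t q).card ≤ kernelBound q t := by
  have := N.finite_nodes
  set K : Set V := {y | IsKept N.graph N.key t q y}
  have hsub : (N.kernel t q : Set ℕ) ⊆
      (fun p : V × V => Nat.pair (N.key p.1) (N.key p.2)) '' (K ×ˢ K) := by
    intro a ha
    obtain ⟨x, y, hx, hy, -, rfl⟩ := (N.mem_kernel t q).1 ha
    exact ⟨(x, y), ⟨hx, hy⟩, rfl⟩
  calc (N.kernel t q).card = (N.kernel t q : Set ℕ).ncard := (Set.ncard_coe_finset _).symm
    _ ≤ (K ×ˢ K).ncard := (Set.ncard_le_ncard hsub).trans (Set.ncard_image_le (Set.toFinite _))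
    _ = K.ncard ^ 2 := by rw [Set.ncard_prod, sq]
    _ ≤ kernelBound q t := Nat.pow_le_pow_left (ncard_isKept_le N.key_injective hX ht) 2

variable {H : SimpleGraph W} {t q}

theorem exists_embedding_of_isCopy {φ : W → ℕ} (hφ : IsCopy H (N.kernel t q) φ) :
    ∃ ψ : H ↪g N.graph, ∀ w, N.key (ψ w) = φ w := by
  have hex : ∀ w, ∃ x, IsKept N.graph N.key t q x ∧ N.key x = φ w := fun w => by
    obtain ⟨x, y, hx, -, -, heq⟩ := (N.mem_kernel t q).1 ((hφ.2 w w).2 (Or.inl rfl))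
    exact ⟨x, hx, (Nat.pair_eq_pair.1 heq).1.symm⟩
  choose ψ hkept hψ using hex
  have hinj : Function.Injective ψ := fun a b hab => hφ.1 (by rw [← hψ, ← hψ, hab])
  have hadj : ∀ {a b}, N.graph.Adj (ψ a) (ψ b) ↔ H.Adj a b := by
    intro a b
    have hiff := hφ.2 a b
    rw [← hψ, ← hψ, pair_mem_kernel, and_iff_right (hkept a), and_iff_right (hkept b),
      hinj.eq_iff] at hiff
    rcases eq_or_ne a b with rfl | hab
    · exact iff_of_false (N.graph.irrefl) (H.irrefl)
    · rwa [or_iff_right hab, or_iff_right hab] at hiff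
  exact ⟨⟨⟨ψ, hinj⟩, hadj⟩, hψ⟩

theorem isCopy_kernel_of_isKept (ψ : H ↪g N.graph)
    (hψ : ∀ w, IsKept N.graph N.key t q (ψ w)) :
    IsCopy H (N.kernel t q) fun w => N.key (ψ w) := by
  refine ⟨N.key_injective.comp ψ.injective, fun w w' => ?_⟩
  rw [pair_mem_kernel, and_iff_right (hψ w), and_iff_right (hψ w'), ψ.injective.eq_iff,
    ψ.map_adj_iff]

theorem exists_isCopy_kernel_iff [Finite W] (hq : Nat.card W ≤ q) :
    (∃ φ, IsCopy H (N.kernel t q) φ) ↔ H.IsIndContained N.graph := by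
  constructor
  · rintro ⟨φ, hφ⟩
    obtain ⟨ψ, -⟩ := N.exists_embedding_of_isCopy hφ
    exact ⟨ψ⟩
  · rintro ⟨φ⟩
    obtain ⟨ψ, hψ⟩ := exists_embedding_isKept N.key t hq φ
    exact ⟨_, N.isCopy_kernel_of_isKept ψ hψ⟩

theorem isInducedDetection_kernelAnswer [Finite W] (hq : Nat.card W ≤ q) :
    IsInducedDetection N.graph H fun x => kernelAnswer H (N.kernel t q) (N.key x) := by
  have hiff := N.exists_isCopy_kernel_iff (H := H) (t := t) hq
  refine ⟨fun x => ?_, fun hH => ?_, fun hH x => ?_⟩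
  · simp only [← hiff, kernelAnswer]
    split_ifs with h <;> simp only [h]
  · have h := hiff.2 hH
    obtain ⟨ψ, hψ⟩ := N.exists_embedding_of_isCopy h.choose_spec
    refine ⟨ψ, fun x w => ?_⟩
    simp only [kernelAnswer, dif_pos h]
    exact (h.choose_spec.1.isPartialInv w (N.key x)).trans
      (by rw [← hψ, N.key_injective.eq_iff])
  · simp only [kernelAnswer, dif_neg (mt hiff.1 hH)]

end Kernel

end CongestNetwork

/-- Local data of a node of degree `d` in a kernel phase. -/
structure KernelData (d : ℕ) where
  /-- the identifiers of the neighbours, by ports -/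
  nbrs : Fin d → ℕ
  /-- the identifiers of the neighbours of the neighbours, possibly truncated, by ports -/
  nbhds : Fin d → Finset ℕ
  /-- the known part of the kernel -/
  items : Finset ℕ

namespace KernelData

variable {d : ℕ} (t q : ℕ) (σ : KernelData d)

/-- The neighbour at port `i` is recognized as a kept node. Its twins are neighbours as well, so the
node can compute its rank among them. -/
def Keeps (i : Fin d) : Prop :=
  t < (σ.nbhds i).card ∨
    ({j | σ.nbhds j = σ.nbhds i ∧ σ.nbrs j < σ.nbrs i} : Finset (Fin d)).card ≤ q

open Classical in
/-- The part of the kernel that a kept node with identifier `id` contributes: the encoded pairs with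
first component `id`. -/
noncomputable def ownItems (id : ℕ) : Finset ℕ :=
  insert (Nat.pair id id) (({i | σ.Keeps t q i} : Finset (Fin d)).image fun i =>
    Nat.pair id (σ.nbrs i))

end KernelData

open Classical in
/-- The phase that computes the kernel for `t` and gives an answer if the kernel is small. In the
blocks `0`, `1` and `2` the nodes learn the identifiers of their neighbours, then the identifiers at
distance two, and then from their neighbours whether they are kept themselves; in all further blocks
the kernel is flooded. -/
noncomputable def kernelPhase {W : Type u} (H : SimpleGraph W) (t : ℕ) :
    Phase (DetectionAnswer W) where
  Loc := KernelData
  start _ := ⟨fun _ => 0, fun _ => ∅, ∅⟩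
  send
    | 0, info, _, _ => {info.id}
    | 1, _, σ, _ => Finset.univ.image σ.nbrs
    | 2, _, σ, i => if σ.Keeps t (Nat.card W) i then {0} else ∅
    | _ + 3, _, σ, _ => σ.items
  step
    | 0, _, σ, inb => { σ with nbrs := fun i => (inb i).sup _root_.id }
    | 1, _, σ, inb => { σ with nbhds := inb }
    | 2, info, σ, inb =>
      { σ with items :=
          if Finset.univ.biUnion inb = ∅ then ∅ else σ.ownItems t (Nat.card W) info.id }
    | _ + 3, _, σ, inb => { σ with items := σ.items ∪ Finset.univ.biUnion inb }
  result info σ :=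
    if σ.items.card ≤ kernelBound (Nat.card W) t then some (kernelAnswer H σ.items info.id)
    else none
  cap := kernelBound (Nat.card W) t + 1
  blocks := kernelBound (Nat.card W) t + 4
  cap_pos := Nat.succ_pos _
  blocks_pos := Nat.succ_pos _

namespace CongestNetwork

variable {V : Type v} {W : Type u} (N : CongestNetwork V)

section Ports

theorem exists_port {x y : V} (h : N.graph.Adj x y) : ∃ i, (N.port x i : V) = y :=
  ⟨(N.port x).symm ⟨y, h⟩, by rw [Equiv.apply_symm_apply]⟩

theorem adj_port (x : V) (i : Fin (N.deg x)) : N.graph.Adj x (N.port x i) := (N.port x i).2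

theorem port_injective (x : V) : Function.Injective fun i => (N.port x i : V) :=
  Subtype.val_injective.comp (N.port x).injective

theorem port_backPort (x : V) (i : Fin (N.deg x)) :
    (N.port (N.port x i) (N.backPort x i) : V) = x := by
  rw [backPort, Equiv.apply_symm_apply]

theorem ncard_neighborSet (x : V) : (N.graph.neighborSet x).ncard = N.deg x := by
  rw [← Nat.card_coe_set_eq, ← Nat.card_congr (N.port x), Nat.card_fin]

/-- The identifiers of the neighbours of a node. -/
def nbrKeys (x : V) : Finset ℕ := Finset.univ.image fun i => N.key (N.port x i)

theorem coe_nbrKeys (x : V) : (N.nbrKeys x : Set ℕ) = N.key '' N.graph.neighborSet x := by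
  ext a
  rw [nbrKeys, Finset.mem_coe, Finset.mem_image]
  constructor
  · rintro ⟨i, -, rfl⟩
    exact ⟨_, N.adj_port x i, rfl⟩
  · rintro ⟨y, hy, rfl⟩
    obtain ⟨i, rfl⟩ := N.exists_port hy
    exact ⟨i, Finset.mem_univ i, rfl⟩

theorem nbrKeys_eq_nbrKeys_iff {x y : V} :
    N.nbrKeys x = N.nbrKeys y ↔ N.graph.neighborSet x = N.graph.neighborSet y := by
  rw [← Finset.coe_inj, coe_nbrKeys, coe_nbrKeys, N.key_injective.image_injective.eq_iff]

theorem card_nbrKeys (x : V) : (N.nbrKeys x).card = N.deg x := by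
  rw [← Set.ncard_coe_finset, coe_nbrKeys, Set.ncard_image_of_injective _ N.key_injective,
    ncard_neighborSet]

theorem lt_of_mem_nbrKeys {x : V} {a : ℕ} (ha : a ∈ N.nbrKeys x) : a < N.idBound ^ 2 := by
  obtain ⟨i, -, rfl⟩ := Finset.mem_image.1 ha
  exact N.key_lt_sq _

end Ports

section KernelData

/-- The local data of node `x` after the first two blocks of a phase in which `m` numbers can be
sent per block. -/
noncomputable def twoBlockData (m : ℕ) (x : V) : KernelData (N.deg x) :=
  ⟨fun i => N.key (N.port x i), fun i => truncate m (N.nbrKeys (N.port x i)), ∅⟩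

theorem twinRank_port (x : V) (i : Fin (N.deg x)) :
    twinRank N.graph N.key (N.port x i) =
      {j | N.graph.neighborSet (N.port x j) = N.graph.neighborSet (N.port x i) ∧
        N.key (N.port x j) < N.key (N.port x i)}.ncard := by
  rw [← Set.ncard_image_of_injective _ (N.port_injective x), twinRank]
  congr 1
  ext z
  constructor
  · rintro ⟨htwin, hlt⟩
    obtain ⟨j, rfl⟩ :=
      N.exists_port ((adj_congr_of_neighborSet_eq htwin x).2 (N.adj_port x i).symm).symm
    exact ⟨j, ⟨htwin, hlt⟩, rfl⟩
  · rintro ⟨j, hj, rfl⟩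
    exact hj

theorem keeps_twoBlockData {t q m : ℕ} (htm : t < m) (x : V) (i : Fin (N.deg x)) :
    (N.twoBlockData m x).Keeps t q i ↔ IsKept N.graph N.key t q (N.port x i) := by
  have hdeg : t < (truncate m (N.nbrKeys (N.port x i))).card ↔
      t < (N.graph.neighborSet (N.port x i)).ncard := by
    rw [card_truncate, card_nbrKeys, ncard_neighborSet, lt_min_iff, and_iff_right htm]
  rw [KernelData.Keeps, IsKept, twoBlockData, hdeg]
  refine or_congr_right' fun hlow => ?_
  rw [not_lt, ncard_neighborSet, ← card_nbrKeys] at hlow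
  simp only [truncate_eq_truncate_iff (hlow.trans_lt htm), nbrKeys_eq_nbrKeys_iff]
  rw [twinRank_port, ← Set.ncard_coe_finset, Finset.coe_filter_univ]

variable {N} in
theorem mem_ownItems_twoBlockData {t q m : ℕ} (htm : t < m) {x : V}
    (hx : IsKept N.graph N.key t q x) {a : ℕ} :
    a ∈ (N.twoBlockData m x).ownItems t q (N.key x) ↔ ∃ y, IsKept N.graph N.key t q y ∧
      (x = y ∨ N.graph.Adj x y) ∧ a = Nat.pair (N.key x) (N.key y) := by
  simp only [KernelData.ownItems, Finset.mem_insert, Finset.mem_image, Finset.mem_filter,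
    Finset.mem_univ, true_and, N.keeps_twoBlockData htm]
  constructor
  · rintro (rfl | ⟨i, hi, rfl⟩)
    · exact ⟨x, hx, Or.inl rfl, rfl⟩
    · exact ⟨_, hi, Or.inr (N.adj_port x i), rfl⟩
  · rintro ⟨y, hy, rfl | hadj, rfl⟩
    · exact Or.inl rfl
    · obtain ⟨i, rfl⟩ := N.exists_port hadj
      exact Or.inr ⟨i, hy, rfl⟩

end KernelData

section KernelPhase

variable (H : SimpleGraph W) (t : ℕ)

theorem blockRun_kernelPhase_one (x : V) : N.blockRun (kernelPhase H t) 1 x =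
    (⟨fun i => N.key (N.port x i), fun _ => ∅, ∅⟩ : KernelData (N.deg x)) := by
  have hrecv : N.received (kernelPhase H t) 0 (kernelPhase H t).cap x =
      fun i => {N.key (N.port x i)} := funext fun i =>
    (N.received_eq_truncate (S := {N.key (N.port x i)}) rfl
      (fun _ ha => Finset.mem_singleton.1 ha ▸ N.key_lt_sq _) _).trans
      (truncate_of_card_le (Nat.succ_pos _))
  rw [blockRun_succ, hrecv]
  exact congrArg (fun nbrs => (⟨nbrs, fun _ => ∅, ∅⟩ : KernelData _))
    (funext fun i => Finset.sup_singleton)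

theorem blockRun_kernelPhase_two (x : V) : N.blockRun (kernelPhase H t) 2 x =
    N.twoBlockData (kernelBound (Nat.card W) t + 1) x := by
  have hrecv : N.received (kernelPhase H t) 1 (kernelPhase H t).cap x =
      fun i => truncate (kernelBound (Nat.card W) t + 1) (N.nbrKeys (N.port x i)) := funext fun i =>
    N.received_eq_truncate (by rw [blockRun_kernelPhase_one]; rfl)
      (fun _ => N.lt_of_mem_nbrKeys) _
  rw [blockRun_succ, hrecv, blockRun_kernelPhase_one]
  rfl

open Classical in
theorem received_kernelPhase_two (x : V) (i : Fin (N.deg x)) :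
    N.received (kernelPhase H t) 2 (kernelPhase H t).cap x i =
      if IsKept N.graph N.key t (Nat.card W) x then {0} else ∅ := by
  have hkeeps := N.keeps_twoBlockData (q := Nat.card W)
    ((lt_kernelBound (Nat.card W) t).trans (Nat.lt_succ_self _)) (N.port x i) (N.backPort x i)
  rw [port_backPort, ← N.blockRun_kernelPhase_two H t] at hkeeps
  have hidBound : 0 < N.idBound := (Nat.zero_le _).trans_lt (N.key_lt x)
  have hcard : (if IsKept N.graph N.key t (Nat.card W) x then {0} else ∅ : Finset ℕ).card ≤
      (kernelPhase H t).cap := by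
    split_ifs
    · exact Nat.succ_pos _
    · exact Nat.zero_le _
  rw [N.received_eq_truncate (if_congr hkeeps rfl rfl), truncate_of_card_le hcard]
  intro a ha
  split_ifs at ha
  · rw [Finset.mem_singleton.1 ha]
    exact pow_pos hidBound 2
  · exact absurd ha (Finset.notMem_empty a)

/-- The part of the kernel that node `x` knows after `s` blocks of flooding. -/
noncomputable def floodItems (s : ℕ) (x : V) : Finset ℕ :=
  (N.blockRun (kernelPhase H t) (s + 3) x : KernelData (N.deg x)).items

variable {N}

theorem mem_floodItems_zero (hdeg : ∀ x, N.deg x ≠ 0) {x : V} {a : ℕ} :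
    a ∈ N.floodItems H t 0 x ↔ IsKept N.graph N.key t (Nat.card W) x ∧
      ∃ y, IsKept N.graph N.key t (Nat.card W) y ∧ (x = y ∨ N.graph.Adj x y) ∧
        a = Nat.pair (N.key x) (N.key y) := by
  have hitems : N.floodItems H t 0 x =
      if Finset.univ.biUnion (N.received (kernelPhase H t) 2 (kernelPhase H t).cap x) = ∅ then ∅
      else (N.twoBlockData (kernelBound (Nat.card W) t + 1) x).ownItems t (Nat.card W) (N.key x) :=
    N.blockRun_kernelPhase_two H t x ▸ rfl
  rw [hitems, funext (N.received_kernelPhase_two H t x)]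
  have : NeZero (N.deg x) := ⟨hdeg x⟩
  by_cases hx : IsKept N.graph N.key t (Nat.card W) x
  · have hne : (Finset.univ : Finset (Fin (N.deg x))).biUnion (fun _ => ({0} : Finset ℕ)) ≠ ∅ :=
      Finset.ne_empty_of_mem
        (Finset.mem_biUnion.2 ⟨0, Finset.mem_univ _, Finset.mem_singleton_self 0⟩)
    simp only [if_pos hx, if_neg hne, and_iff_right hx]
    exact mem_ownItems_twoBlockData ((lt_kernelBound _ t).trans (Nat.lt_succ_self _)) hx
  · have hempty : (Finset.univ : Finset (Fin (N.deg x))).biUnion (fun _ => (∅ : Finset ℕ)) = ∅ :=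
      Finset.subset_empty.1 (Finset.biUnion_subset.2 fun _ _ => Finset.Subset.refl _)
    simp only [hx, if_false, if_pos hempty, Finset.notMem_empty, false_and]

theorem mem_kernel_iff_exists_mem_floodItems_zero (hdeg : ∀ x, N.deg x ≠ 0) {a : ℕ} :
    a ∈ N.kernel t (Nat.card W) ↔ ∃ x, a ∈ N.floodItems H t 0 x := by
  simp only [mem_kernel, mem_floodItems_zero H t hdeg, exists_and_left]

theorem floodItems_succ (s : ℕ) (x : V) : N.floodItems H t (s + 1) x = N.floodItems H t s x ∪
    Finset.univ.biUnion (N.received (kernelPhase H t) (s + 3) (kernelPhase H t).cap x) :=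
  rfl

theorem floodItems_subset_kernel (hdeg : ∀ x, N.deg x ≠ 0) (s : ℕ) (x : V) :
    N.floodItems H t s x ⊆ N.kernel t (Nat.card W) := by
  induction s generalizing x with
  | zero => exact fun a ha => (mem_kernel_iff_exists_mem_floodItems_zero H t hdeg).2 ⟨x, ha⟩
  | succ s ih =>
    rw [floodItems_succ]
    refine Finset.union_subset (ih x) (Finset.biUnion_subset.2 fun i _ => ?_)
    exact ((truncate_subset _ _).trans (Finset.filter_subset _ _)).trans (ih (N.port x i))

theorem received_kernelPhase_add_three (hdeg : ∀ x, N.deg x ≠ 0) (s : ℕ) (x : V)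
    (i : Fin (N.deg x)) : N.received (kernelPhase H t) (s + 3) (kernelPhase H t).cap x i =
      truncate (kernelBound (Nat.card W) t + 1) (N.floodItems H t s (N.port x i)) :=
  N.received_eq_truncate rfl
    (fun _ ha => N.lt_of_mem_kernel t _ (floodItems_subset_kernel H t hdeg s _ ha)) _

theorem isFlooding_floodItems (hdeg : ∀ x, N.deg x ≠ 0) :
    IsFlooding N.graph (kernelBound (Nat.card W) t) (N.floodItems H t) := by
  intro s x a
  simp only [floodItems_succ, Finset.mem_union, Finset.mem_biUnion, Finset.mem_univ, true_and,
    received_kernelPhase_add_three H t hdeg]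
  refine or_congr_right ⟨fun ⟨i, hi⟩ => ⟨_, N.adj_port x i, hi⟩, fun ⟨y, hxy, hy⟩ => ?_⟩
  obtain ⟨i, rfl⟩ := N.exists_port hxy
  exact ⟨i, hy⟩

theorem phaseResult_kernelPhase (hG : N.graph.Connected) (hdeg : ∀ x, N.deg x ≠ 0) (x : V) :
    N.phaseResult (kernelPhase H t) x =
      if (N.kernel t (Nat.card W)).card ≤ kernelBound (Nat.card W) t then
        some (kernelAnswer H (N.kernel t (Nat.card W)) (N.key x))
      else none := by
  have hflood := isFlooding_floodItems H t hdeg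
  have hitem : ∀ z, IsKept N.graph N.key t (Nat.card W) z →
      Nat.pair (N.key z) (N.key z) ∈ N.floodItems H t 0 z := fun z hz =>
    (mem_floodItems_zero H t hdeg).2 ⟨hz, z, hz, Or.inl rfl, rfl⟩
  have hkernel := fun a => mem_kernel_iff_exists_mem_floodItems_zero (a := a) H t hdeg
  have hcard := hflood.card_le_iff hG N.pair_key_injective hitem hkernel x
  change (if (N.floodItems H t (kernelBound (Nat.card W) t + 1) x).card ≤ _ then
    some (kernelAnswer H (N.floodItems H t (kernelBound (Nat.card W) t + 1) x) (N.key x))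
    else none) = _
  refine ite_congr (propext hcard) (fun h => ?_) fun _ => rfl
  rw [hflood.eq_of_card_le hG N.pair_key_injective hitem hkernel (hcard.2 h)]

end KernelPhase

end CongestNetwork

section Rounds

theorem kernelBound_mono (q : ℕ) : Monotone (kernelBound q) := fun _ _ h =>
  Nat.pow_le_pow_left
    (Nat.add_le_add h (Nat.mul_le_mul_right _ (Nat.pow_le_pow_right two_pos h))) 2

theorem kernelBound_le (q t : ℕ) : kernelBound q t ≤ 2 ^ (2 * (t + q + 1)) := by
  have hbase : t + 2 ^ t * (q + 1) ≤ 2 ^ (t + q + 1) :=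
    calc t + 2 ^ t * (q + 1) ≤ 2 ^ t + 2 ^ t * (q + 1) :=
          Nat.add_le_add_right Nat.lt_two_pow_self.le _
      _ = 2 ^ t * (q + 1 + 1) := by ring
      _ ≤ 2 ^ t * 2 ^ (q + 1) := Nat.mul_le_mul_left _ Nat.lt_two_pow_self
      _ = 2 ^ (t + q + 1) := by rw [← pow_add, add_assoc]
  calc kernelBound q t ≤ (2 ^ (t + q + 1)) ^ 2 := Nat.pow_le_pow_left hbase 2
    _ = 2 ^ (2 * (t + q + 1)) := by rw [← pow_mul, mul_comm]

theorem sum_rounds_le {q s t : ℕ} (hst : s ≤ t) (ht : 0 < t) :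
    ∑ r ∈ Finset.range (s + 1), (kernelBound q r + 4) * (kernelBound q r + 1) ≤
      2 ^ (11 * (t + q)) := by
  have hbound : ∀ r ∈ Finset.range (s + 1),
      (kernelBound q r + 4) * (kernelBound q r + 1) ≤ (2 ^ (2 * (t + q + 1) + 1)) ^ 2 := by
    intro r hr
    have hr : kernelBound q r ≤ 2 ^ (2 * (t + q + 1)) :=
      (kernelBound_mono q ((Finset.mem_range_succ_iff.1 hr).trans hst)).trans (kernelBound_le q t)
    have hfour : 2 ^ 2 ≤ 2 ^ (2 * (t + q + 1)) := Nat.pow_le_pow_right two_pos (by omega)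
    rw [sq, pow_succ]
    exact Nat.mul_le_mul (by omega) (by omega)
  calc ∑ r ∈ Finset.range (s + 1), (kernelBound q r + 4) * (kernelBound q r + 1)
      ≤ (s + 1) * (2 ^ (2 * (t + q + 1) + 1)) ^ 2 := by
        simpa only [Finset.card_range, smul_eq_mul] using Finset.sum_le_card_nsmul _ _ _ hbound
    _ ≤ 2 ^ (t + q) * (2 ^ (2 * (t + q + 1) + 1)) ^ 2 :=
        Nat.mul_le_mul_right _ ((by omega : s + 1 ≤ t + q + 1).trans Nat.lt_two_pow_self)
    _ = 2 ^ (5 * (t + q) + 6) := by ring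
    _ ≤ 2 ^ (11 * (t + q)) := Nat.pow_le_pow_right two_pos (by omega)

theorem size_sq_le_clog {n : ℕ} (hn : 1 < n) : (n ^ 2).size ≤ 3 * Nat.clog 2 n := by
  have hpos : 0 < Nat.clog 2 n := Nat.clog_pos one_lt_two hn
  refine Nat.size_le.2 ?_
  calc n ^ 2 ≤ (2 ^ Nat.clog 2 n) ^ 2 := Nat.pow_le_pow_left (Nat.le_pow_clog one_lt_two n) 2
    _ = 2 ^ (2 * Nat.clog 2 n) := by rw [← pow_mul, mul_comm]
    _ < 2 ^ (3 * Nat.clog 2 n) := Nat.pow_lt_pow_right one_lt_two (by omega)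

end Rounds

/-- The algorithm that runs `kernelPhase H t` for `t = 0, 1, …`. A node of degree `0` is the only
node of a connected network and answers at once. -/
noncomputable def detectionAlgorithm {W : Type u} (H : SimpleGraph W) :
    CongestAlgorithm (DetectionAnswer W) :=
  Phase.toCongest (kernelPhase H) fun info =>
    if info.degree = 0 then some (kernelAnswer H {Nat.pair info.id info.id} info.id) else none

namespace CongestNetwork

section Detection

variable {V : Type v} {W : Type u} {N : CongestNetwork V} (H : SimpleGraph W)

theorem deg_ne_zero [Nontrivial V] (hG : N.graph.Connected) (x : V) : N.deg x ≠ 0 := by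
  obtain ⟨y, hxy⟩ := hG.preconnected.exists_adj_of_nontrivial x
  obtain ⟨i, -⟩ := N.exists_port hxy
  exact (Nat.zero_le _).trans_lt i.2 |>.ne'

theorem deg_eq_zero [Subsingleton V] (x : V) : N.deg x = 0 := by
  by_contra h
  exact (N.adj_port x ⟨0, Nat.pos_of_ne_zero h⟩).ne (Subsingleton.elim _ _)

variable (N) in
theorem one_lt_idBound [Nontrivial V] : 1 < N.idBound := by
  obtain ⟨x, y, hxy⟩ := exists_pair_ne V
  have := N.key_injective.ne hxy
  have := N.key_lt x
  have := N.key_lt y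
  omega

theorem respectsBandwidth_detectionAlgorithm :
    N.RespectsBandwidth (detectionAlgorithm H) (3 * Nat.clog 2 N.idBound) := by
  intro T x i
  have : Nontrivial V := ⟨x, N.port x i, (N.adj_port x i).ne⟩
  exact (N.respectsBandwidth_toCongest _ _ T x i).trans (size_sq_le_clog N.one_lt_idBound)

variable (N) in
theorem exists_isVertexCover_ncard_eq :
    ∃ X, N.graph.IsVertexCover X ∧ X.ncard = N.graph.vertexCoverNum.toNat := by
  obtain ⟨X, hcard, hX⟩ := N.graph.vertexCoverNum_exists
  exact ⟨X, hX, by rw [Set.ncard_def, hcard]⟩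

variable (N) in
theorem haltsWith_of_subsingleton [Subsingleton V] :
    N.HaltsWith (detectionAlgorithm H) 0 fun x =>
      kernelAnswer H (N.kernel 0 (Nat.card W)) (N.key x) := by
  intro x
  rw [kernel_of_subsingleton]
  exact if_pos (deg_eq_zero x)

theorem exists_haltsWith_of_nontrivial [Nontrivial V] (hG : N.graph.Connected) :
    ∃ s T, T ≤ 2 ^ (11 * (N.graph.vertexCoverNum.toNat + Nat.card W)) ∧
      N.HaltsWith (detectionAlgorithm H) T fun x =>
        kernelAnswer H (N.kernel s (Nat.card W)) (N.key x) := by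
  classical
  have := N.finite_nodes
  obtain ⟨X, hX, hcard⟩ := N.exists_isVertexCover_ncard_eq
  have hsmall : ∃ s, (N.kernel s (Nat.card W)).card ≤ kernelBound (Nat.card W) s :=
    ⟨_, N.card_kernel_le _ _ hX le_rfl⟩
  have hXpos : 0 < X.ncard := by
    obtain ⟨x⟩ := hG.nonempty
    obtain ⟨y, hxy⟩ := hG.preconnected.exists_adj_of_nontrivial x
    exact (Set.ncard_pos).2 ((hX hxy).elim (fun h => ⟨x, h⟩) fun h => ⟨y, h⟩)
  have hdeg : ∀ x, N.deg x ≠ 0 := deg_ne_zero hG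
  have hresult := fun s => phaseResult_kernelPhase H s hG hdeg
  refine ⟨Nat.find hsmall, _, ?_,
    N.haltsWith_of_phaseResult (t := Nat.find hsmall) _ _ (fun x => if_neg (hdeg x))
      (fun s hs x => ?_) fun x => ?_⟩
  · rw [← hcard]
    exact sum_rounds_le (Nat.find_min' hsmall (N.card_kernel_le _ _ hX le_rfl)) hXpos
  · rw [hresult, if_neg (Nat.find_min hsmall hs)]
  · rw [hresult, if_pos (Nat.find_spec hsmall)]

theorem exists_haltsWith_detectionAlgorithm (hG : N.graph.Connected) :
    ∃ s T, T ≤ 2 ^ (11 * (N.graph.vertexCoverNum.toNat + Nat.card W)) ∧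
      N.HaltsWith (detectionAlgorithm H) T fun x =>
        kernelAnswer H (N.kernel s (Nat.card W)) (N.key x) := by
  rcases subsingleton_or_nontrivial V with _ | _
  · exact ⟨0, 0, Nat.zero_le _, N.haltsWith_of_subsingleton H⟩
  · exact exists_haltsWith_of_nontrivial H hG

end Detection

end CongestNetwork

theorem clog_le_mul_clog_of_le_pow {m n c : ℕ} (h : m ≤ n ^ c) :
    Nat.clog 2 m ≤ c * Nat.clog 2 n := by
  refine Nat.clog_le_of_le_pow (h.trans ?_)
  calc n ^ c ≤ (2 ^ Nat.clog 2 n) ^ c := Nat.pow_le_pow_left (Nat.le_pow_clog one_lt_two n) c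
    _ = 2 ^ (c * Nat.clog 2 n) := by rw [← pow_mul, mul_comm]

theorem mainTheorem10_general {W : Type u} [Finite W] (H : SimpleGraph W) :
    ∃ A : CongestAlgorithm (DetectionAnswer W), ∀ (V : Type v) (N : CongestNetwork V),
      N.graph.Connected → N.RespectsBandwidth A (3 * Nat.clog 2 N.idBound) ∧
        ∃ (T : ℕ) (out : V → DetectionAnswer W),
          T ≤ 2 ^ (11 * (N.graph.vertexCoverNum.toNat + Nat.card W)) ∧
          N.HaltsWith A T out ∧ IsInducedDetection N.graph H out := by
  refine ⟨detectionAlgorithm H, fun V N hG =>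
    ⟨CongestNetwork.respectsBandwidth_detectionAlgorithm H, ?_⟩⟩
  obtain ⟨s, T, hT, hhalts⟩ :=
    CongestNetwork.exists_haltsWith_detectionAlgorithm H hG
  exact ⟨T, _, hT, hhalts, N.isInducedDetection_kernelAnswer le_rfl⟩

theorem mainTheorem10 :
    ∃ C : ℕ, ∀ c : ℕ, ∃ b : ℕ,
      ∀ (W : Type u) [Fintype W] (H : SimpleGraph W),
        ∃ A : CongestAlgorithm (DetectionAnswer W),
          ∀ (V : Type v) [Fintype V] (N : CongestNetwork V),
            N.graph.Connected → N.idBound ≤ Fintype.card V ^ c →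
              N.RespectsBandwidth A (b * Nat.clog 2 (Fintype.card V)) ∧
              ∃ (T : ℕ) (out : V → DetectionAnswer W),
                T ≤ 2 ^ (C * (N.graph.vertexCoverNum.toNat + Fintype.card W) ^ 2) ∧
                N.HaltsWith A T out ∧ IsInducedDetection N.graph H out := by
  refine ⟨11, fun c => ⟨3 * c, fun W _ H => ?_⟩⟩
  obtain ⟨A, hA⟩ := mainTheorem10_general.{u, v} H
  refine ⟨A, fun V _ N hG hN => ?_⟩
  obtain ⟨hbandwidth, T, out, hT, hout⟩ := hA V N hG
  refine ⟨fun t x i => (hbandwidth t x i).trans ?_, T, out, hT.trans ?_, hout⟩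
  · rw [mul_assoc]
    exact Nat.mul_le_mul_left 3 (clog_le_mul_clog_of_le_pow hN)
  · rw [Nat.card_eq_fintype_card]
    exact Nat.pow_le_pow_right two_pos
      (Nat.mul_le_mul_left 11 (Nat.le_self_pow two_ne_zero _))
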